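/- For $n\ge 0$ let $G'(n)$ denote the number of two-color partitions of $n$ (partitions of $n$ in which each part is colored red or blue; the order of the parts is irrelevant) whose smallest part is odd, say $2m+1$ with $m\ge 0$, and all of whose red parts are even and lie in the interval $(2m,4m]$; in particular $G'(0)=0$. Write $(A;q)_N=\prod_{k=0}^{N-1}(1-Aq^k)$ and $(A;q)_\infty=\prod_{k\ge 0}(1-Aq^k)$, and let $$\phi_3(q)=\sum_{n=0}^\infty\frac{q^{n^2}}{(-q^2;q^2)_n}$$ be the third order mock theta function. Then, as formal power series in $q$, $$\sum_{n=0}^\infty G'(n)q^n=q^2-q(1+q)\,\phi_3(-q)+\frac{q(3-q)}{2(q;q)_\infty}+\frac{q(1+q)(q^2;q^2)_\infty}{2(-q;q)_\infty^3}.$$ -/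

import Mathlib

open PowerSeries
open scoped PowerSeries.WithPiTopology

namespace TwoColor

/-- A two-color (red and blue) partition of `n`: a partition of some `k` (the multiset of red
parts) together with a partition of some `l` (the multiset of blue parts), where `k + l = n`. -/
abbrev TwoColorPartition (n : ℕ) : Type :=
  Σ kl : {kl : ℕ × ℕ // kl ∈ Finset.HasAntidiagonal.antidiagonal n}, kl.1.1.Partition × kl.1.2.Partition

/-- The multiset of red parts. -/
def redParts {n : ℕ} (p : TwoColorPartition n) : Multiset ℕ := p.2.1.parts

/-- The multiset of blue parts. -/
def blueParts {n : ℕ} (p : TwoColorPartition n) : Multiset ℕ := p.2.2.parts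

/-- The smallest part (over both colors) of `p` is `s`; in particular `p` has a part. -/
def IsSmallestPart {n : ℕ} (p : TwoColorPartition n) (s : ℕ) : Prop :=
  s ∈ redParts p + blueParts p ∧ ∀ x ∈ redParts p + blueParts p, s ≤ x

/-- The smallest part is odd, say `2m + 1`, and all red parts are even and lie in `(2m, 4m]`. -/
def IsAdmissible {n : ℕ} (p : TwoColorPartition n) : Prop :=
  ∃ m : ℕ, IsSmallestPart p (2 * m + 1) ∧
    ∀ x ∈ redParts p, Even x ∧ x ∈ Set.Ioc (2 * m) (4 * m)

/-- `G'(n)`: the number of two-color partitions of `n` with odd smallest part `2m + 1`, all of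
whose red parts are even and lie in `(2m, 4m]`. -/
noncomputable def G' (n : ℕ) : ℕ := Nat.card {p : TwoColorPartition n // IsAdmissible p}

/-- The finite `q`-Pochhammer symbol `(a; q)_N = (1 - a)(1 - aq) ⋯ (1 - aq^(N-1))`. -/
noncomputable def qPoch (a q : ℚ⟦X⟧) (N : ℕ) : ℚ⟦X⟧ := ∏ k ∈ Finset.range N, (1 - a * q ^ k)

/-- The infinite `q`-Pochhammer symbol `(a; q)_∞ = ∏_{k ≥ 0} (1 - a q^k)`. -/
noncomputable def qPochInf (a q : ℚ⟦X⟧) : ℚ⟦X⟧ := ∏' k : ℕ, (1 - a * q ^ k)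

/-- The third order mock theta function `φ₃(Q) = ∑_{n ≥ 0} Q^(n²) / (-Q²; Q²)_n`. -/
noncomputable def phi3 (Q : ℚ⟦X⟧) : ℚ⟦X⟧ :=
  ∑' n : ℕ, Q ^ (n ^ 2) * (qPoch (-Q ^ 2) (Q ^ 2) n)⁻¹

theorem tendsto_order_mul_pow {q : ℚ⟦X⟧} (hq : constantCoeff q = 0) (a : ℕ → ℚ⟦X⟧)
    (e : ℕ → ℕ) (he : ∀ n, n ≤ e n) :
    Filter.Tendsto (fun k ↦ (a k * q ^ e k).order) Filter.atTop (nhds ⊤) := by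
  refine ENat.tendsto_nhds_top_iff_natCast_lt.mpr fun n ↦
    Filter.eventually_atTop.mpr ⟨n + 1, fun k hk ↦ ?_⟩
  have h1 : X ^ e k ∣ a k * q ^ e k :=
    Dvd.dvd.mul_left (pow_dvd_pow_of_dvd (X_dvd_iff.mpr hq) _) _
  have h2 : ((e k : ℕ) : ℕ∞) ≤ (a k * q ^ e k).order := le_order _ _ fun i hi ↦
    X_pow_dvd_iff.mp h1 i (by exact_mod_cast hi)
  refine lt_of_lt_of_le ?_ h2
  have := he k
  exact_mod_cast (by omega : n < e k)

/-- The product defining `(a; q)_∞` converges as soon as `q` has no constant term. -/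
theorem multipliable_qPochInf (a : ℚ⟦X⟧) {q : ℚ⟦X⟧} (hq : constantCoeff q = 0) :
    Multipliable fun k : ℕ ↦ 1 - a * q ^ k := by
  have := WithPiTopology.multipliable_one_add_of_tendsto_order_atTop_nhds_top ℚ
    (tendsto_order_mul_pow hq (fun _ ↦ -a) id fun _ ↦ le_rfl)
  simpa [sub_eq_add_neg] using this

/-- `(a; q)_∞` is the limit of `(a; q)_N` as `N → ∞`. -/
theorem tendsto_qPoch (a : ℚ⟦X⟧) {q : ℚ⟦X⟧} (hq : constantCoeff q = 0) :
    Filter.Tendsto (qPoch a q) Filter.atTop (nhds (qPochInf a q)) :=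
  (multipliable_qPochInf a hq).hasProd.tendsto_prod_nat

/-- The series defining `φ₃(Q)` converges as soon as `Q` has no constant term. -/
theorem summable_phi3 {Q : ℚ⟦X⟧} (hQ : constantCoeff Q = 0) :
    Summable fun n : ℕ ↦ Q ^ (n ^ 2) * (qPoch (-Q ^ 2) (Q ^ 2) n)⁻¹ := by
  have := WithPiTopology.summable_of_tendsto_order_atTop_nhds_top ℚ
    (tendsto_order_mul_pow hQ (fun n ↦ (qPoch (-Q ^ 2) (Q ^ 2) n)⁻¹) (fun n ↦ n ^ 2)
      fun n ↦ Nat.le_self_pow (by norm_num) n)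
  simpa [mul_comm] using this

end TwoColor

/-! An admissible partition with smallest part `2m + 1` splits into red even parts in `(2m, 4m]` and
blue parts that are at least `2m + 1` and include it, since the odd smallest part cannot be red.
Summing over `m` and multiplying by `(q;q)_∞` turns the generating function into `q` times
`mainSeries 0`.

`mainSeries` is embedded in a family with parameter `x = q^(2k+1)`, which obeys a first-order
inhomogeneous recurrence in `k`. A Lambert series and `(q;q)_∞`-type products times a mock series
solve the same recurrence (`mainSeries_succ`). The homogeneous recurrence gains a factor `q` at each
step, so it has only the zero solution, and the two sides agree. The mock series at `k = 1` is
`φ₃(-q)` up to its first term and a factor `-q`.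

The Lambert series is then evaluated by `((q;q)_∞ / (-q;q)_∞)^2 = 1 - 4q * lambertSeries 0`,
obtained from a case of Ramanujan's `₁ψ₁` sum: a functional equation in `b` links `b = 1`, where the
series is one-sided and the `q`-binomial theorem applies, to `b = -1`, where it is the Lambert
series. Substituting gives the theorem. -/

namespace TwoColor

open Filter Topology

/-! ### Convergence of formal power series and telescoping sums. -/

section Convergence

theorem summable_of_X_pow_dvd {a : ℕ → ℚ⟦X⟧} (h : ∀ n, X ^ n ∣ a n) : Summable a := by
  choose c hc using h
  have := WithPiTopology.summable_of_tendsto_order_atTop_nhds_top ℚ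
    (tendsto_order_mul_pow (q := X) (by simp) c id fun _ ↦ le_rfl)
  convert! this using 2 with n
  rw [hc n, id, mul_comm]

theorem tendsto_zero_of_X_pow_dvd {a : ℕ → ℚ⟦X⟧} (h : ∀ n, X ^ n ∣ a n) :
    Tendsto a atTop (𝓝 0) :=
  (summable_of_X_pow_dvd h).tendsto_atTop_zero

theorem tsum_eq_of_telescoping {a g : ℕ → ℚ⟦X⟧} {l : ℚ⟦X⟧} (ha : Summable a)
    (h : ∀ n, a n = g n - g (n + 1)) (hg : Tendsto g atTop (𝓝 l)) : ∑' n, a n = g 0 - l := by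
  refine tendsto_nhds_unique ha.hasSum.tendsto_sum_nat ?_
  have : (fun n ↦ ∑ i ∈ Finset.range n, a i) = fun n ↦ g 0 - g n := by
    funext n
    rw [Finset.sum_congr rfl fun i _ ↦ h i, Finset.sum_range_sub']
  rw [this]
  exact tendsto_const_nhds.sub hg

theorem X_pow_dvd_tsum {a : ℕ → ℚ⟦X⟧} {N : ℕ} (h : ∀ n, X ^ N ∣ a n) : X ^ N ∣ ∑' n, a n := by
  by_cases ha : Summable a
  · rw [X_pow_dvd_iff]
    intro m hm
    rw [ha.map_tsum _ (WithPiTopology.continuous_coeff ℚ m)]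
    simp [fun n ↦ X_pow_dvd_iff.mp (h n) m hm]
  · simp [tsum_eq_zero_of_not_summable ha]

theorem eq_zero_of_forall_X_pow_dvd {a : ℚ⟦X⟧} (h : ∀ n, X ^ n ∣ a) : a = 0 := by
  ext n
  simpa using X_pow_dvd_iff.mp (h (n + 1)) n (by omega)

/-- Convergence is coefficientwise, and each coefficient of an inverse is a polynomial in earlier
ones and the inverse constant term; hence strong induction on the degree. -/
theorem tendsto_inv {ι : Type*} {l : Filter ι} {f : ι → ℚ⟦X⟧} {g : ℚ⟦X⟧}
    (h : Tendsto f l (𝓝 g)) (hg : constantCoeff g ≠ 0) :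
    Tendsto (fun i ↦ (f i)⁻¹) l (𝓝 g⁻¹) := by
  have h' := (WithPiTopology.tendsto_iff_coeff_tendsto ℚ _ _ _).mp h
  have h0 : Tendsto (fun i ↦ (constantCoeff (f i))⁻¹) l (𝓝 (constantCoeff g)⁻¹) := by
    simpa using (h' 0).inv₀ (by simpa using hg)
  rw [WithPiTopology.tendsto_iff_coeff_tendsto]
  intro d
  induction d using Nat.strong_induction_on with
  | _ d ih =>
    refine (tendsto_congr fun i ↦ coeff_inv d (f i)).mpr ?_
    rw [coeff_inv]
    split_ifs with hd
    · exact h0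
    · refine h0.neg.mul (tendsto_finsetSum _ fun x _ ↦ ?_)
      split_ifs with hx
      · exact (h' _).mul (ih _ hx)
      · exact tendsto_const_nhds

end Convergence

/-! ### Identities for `q`-Pochhammer symbols. -/

section Pochhammer

theorem qPoch_zero (a q : ℚ⟦X⟧) : qPoch a q 0 = 1 := by simp [qPoch]

theorem qPoch_succ (a q : ℚ⟦X⟧) (n : ℕ) :
    qPoch a q (n + 1) = qPoch a q n * (1 - a * q ^ n) := by
  simp [qPoch, Finset.prod_range_succ]

theorem qPoch_succ' (a q : ℚ⟦X⟧) (n : ℕ) :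
    qPoch a q (n + 1) = (1 - a) * qPoch (a * q) q n := by
  simp [qPoch, Finset.prod_range_succ', pow_succ', mul_assoc, mul_comm]

theorem constantCoeff_qPoch {a : ℚ⟦X⟧} (ha : constantCoeff a = 0) (q : ℚ⟦X⟧) (n : ℕ) :
    constantCoeff (qPoch a q n) = 1 := by
  simp [qPoch, map_prod, ha]

theorem constantCoeff_qPochInf {a q : ℚ⟦X⟧} (ha : constantCoeff a = 0)
    (hq : constantCoeff q = 0) : constantCoeff (qPochInf a q) = 1 := by
  have h := ((WithPiTopology.continuous_constantCoeff ℚ).tendsto _).comp (tendsto_qPoch a hq)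
  refine tendsto_nhds_unique h ?_
  simp [Function.comp_def, constantCoeff_qPoch ha]

theorem qPochInf_eq_mul (a : ℚ⟦X⟧) {q : ℚ⟦X⟧} (hq : constantCoeff q = 0) :
    qPochInf a q = (1 - a) * qPochInf (a * q) q := by
  refine tendsto_nhds_unique ((tendsto_add_atTop_iff_nat 1).mpr (tendsto_qPoch a hq)) ?_
  simp_rw [qPoch_succ']
  exact (tendsto_qPoch _ hq).const_mul _

theorem qPoch_mul_inv {a : ℚ⟦X⟧} (ha : constantCoeff a = 0) (q : ℚ⟦X⟧) (n : ℕ) :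
    qPoch a q n * (qPoch a q n)⁻¹ = 1 :=
  PowerSeries.mul_inv_cancel _ (by simp [constantCoeff_qPoch ha])

theorem qPochInf_mul_inv {a q : ℚ⟦X⟧} (ha : constantCoeff a = 0) (hq : constantCoeff q = 0) :
    qPochInf a q * (qPochInf a q)⁻¹ = 1 :=
  PowerSeries.mul_inv_cancel _ (by simp [constantCoeff_qPochInf ha hq])

theorem inv_qPoch_eq {a : ℚ⟦X⟧} (ha : constantCoeff a = 0) (q : ℚ⟦X⟧) (n : ℕ) :
    (qPoch a q n)⁻¹ = (qPoch a q (n + 1))⁻¹ * (1 - a * q ^ n) := by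
  have h1 := qPoch_mul_inv ha q n
  have h2 := qPoch_mul_inv ha q (n + 1)
  have h3 := qPoch_succ a q n
  linear_combination (qPoch a q n)⁻¹ * (-h2) + (qPoch a q (n + 1))⁻¹ * (1 - a * q ^ n) * h1
    + (qPoch a q n)⁻¹ * (qPoch a q (n + 1))⁻¹ * h3

theorem inv_qPoch_mul {a : ℚ⟦X⟧} (ha : constantCoeff a = 0) (q : ℚ⟦X⟧) (n : ℕ) :
    (qPoch (a * q) q n)⁻¹ = (qPoch a q (n + 1))⁻¹ * (1 - a) := by
  have h1 := qPoch_mul_inv (a := a * q) (by simp [ha]) q n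
  have h2 := qPoch_mul_inv ha q (n + 1)
  have h3 := qPoch_succ' a q n
  linear_combination (qPoch (a * q) q n)⁻¹ * (-h2) + (qPoch a q (n + 1))⁻¹ * (1 - a) * h1
    + (qPoch (a * q) q n)⁻¹ * (qPoch a q (n + 1))⁻¹ * h3

theorem inv_qPochInf_mul {a q : ℚ⟦X⟧} (ha : constantCoeff a = 0) (hq : constantCoeff q = 0) :
    (qPochInf (a * q) q)⁻¹ = (qPochInf a q)⁻¹ * (1 - a) := by
  have h1 := qPochInf_mul_inv (a := a * q) (q := q) (by simp [ha]) hq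
  have h2 := qPochInf_mul_inv ha hq
  have h3 := qPochInf_eq_mul a hq
  linear_combination (qPochInf (a * q) q)⁻¹ * (-h2) + (qPochInf a q)⁻¹ * (1 - a) * h1
    + (qPochInf (a * q) q)⁻¹ * (qPochInf a q)⁻¹ * h3

theorem tendsto_inv_qPoch {a q : ℚ⟦X⟧} (ha : constantCoeff a = 0) (hq : constantCoeff q = 0) :
    Tendsto (fun n ↦ (qPoch a q n)⁻¹) atTop (𝓝 (qPochInf a q)⁻¹) :=
  tendsto_inv (tendsto_qPoch a hq) (by simp [constantCoeff_qPochInf ha hq])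

theorem qPoch_two_mul (a q : ℚ⟦X⟧) (n : ℕ) :
    qPoch a q (2 * n) = qPoch a (q ^ 2) n * qPoch (a * q) (q ^ 2) n := by
  induction n with
  | zero => simp [qPoch]
  | succ n ih =>
    rw [show 2 * (n + 1) = 2 * n + 1 + 1 by ring, qPoch_succ, qPoch_succ, ih, qPoch_succ,
      qPoch_succ]
    ring

theorem qPochInf_eq_mul_sq (a : ℚ⟦X⟧) {q : ℚ⟦X⟧} (hq : constantCoeff q = 0) :
    qPochInf a q = qPochInf a (q ^ 2) * qPochInf (a * q) (q ^ 2) := by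
  have hq2 : constantCoeff (q ^ 2) = 0 := by simp [hq]
  have h := (tendsto_qPoch a hq).comp (tendsto_id.const_mul_atTop' (r := 2) (by norm_num))
  refine tendsto_nhds_unique h ?_
  simp only [Function.comp_def, id, qPoch_two_mul]
  exact (tendsto_qPoch a hq2).mul (tendsto_qPoch _ hq2)

theorem qPoch_mul_qPoch_neg (a q : ℚ⟦X⟧) (n : ℕ) :
    qPoch a q n * qPoch (-a) q n = qPoch (a ^ 2) (q ^ 2) n := by
  simp only [qPoch, ← Finset.prod_mul_distrib]
  exact Finset.prod_congr rfl fun k _ ↦ by ring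

theorem qPochInf_mul_qPochInf_neg (a : ℚ⟦X⟧) {q : ℚ⟦X⟧} (hq : constantCoeff q = 0) :
    qPochInf a q * qPochInf (-a) q = qPochInf (a ^ 2) (q ^ 2) := by
  have h := (tendsto_qPoch a hq).mul (tendsto_qPoch (-a) hq)
  simp_rw [qPoch_mul_qPoch_neg] at h
  exact tendsto_nhds_unique h (tendsto_qPoch _ (by simp [hq]))

end Pochhammer

/-! ### Reduction of `mainSeries 0` to `φ₃(-q)` and a Lambert series. -/

section MockSeries

/-- `∑ₘ q^(2m) (q²; q²)ₘ / ((-q²; q²)ₘ (-q^(2k+1); q²)ₘ)`. -/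
noncomputable def mainSeries (k : ℕ) : ℚ⟦X⟧ :=
  ∑' m : ℕ, (X ^ 2) ^ m * (qPoch (X ^ 2) (X ^ 2) m * (qPoch (-X ^ 2) (X ^ 2) m)⁻¹ *
    (qPoch (-X ^ (2 * k + 1)) (X ^ 2) m)⁻¹)

/-- `(q²; q²)_∞ / ((-q²; q²)_∞ (-q^(2k+1); q²)_∞)`. -/
noncomputable def mainLimit (k : ℕ) : ℚ⟦X⟧ :=
  qPochInf (X ^ 2) (X ^ 2) * (qPochInf (-X ^ 2) (X ^ 2))⁻¹ *
    (qPochInf (-X ^ (2 * k + 1)) (X ^ 2))⁻¹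

/-- `∑ₙ (-q²)^n / (1 + q^(2k+1+2n))`. -/
noncomputable def lambertSeries (k : ℕ) : ℚ⟦X⟧ :=
  ∑' n : ℕ, (-X ^ 2) ^ n * (1 + X ^ (2 * k + 1) * (X ^ 2) ^ n)⁻¹

/-- `∑ⱼ (-1)^j q^(2kj + j²) / (-q²; q²)_(j+1)`. -/
noncomputable def mockSeries (k : ℕ) : ℚ⟦X⟧ :=
  ∑' j : ℕ, (-1) ^ j * X ^ (2 * k * j + j ^ 2) * (qPoch (-X ^ 2) (X ^ 2) (j + 1))⁻¹

theorem neg_X_pow_mul (k : ℕ) : (-X ^ (2 * k + 1) * X ^ 2 : ℚ⟦X⟧) = -X ^ (2 * (k + 1) + 1) := by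
  ring

theorem X_pow_dvd_X_sq_pow_mul (n : ℕ) (a : ℚ⟦X⟧) : X ^ n ∣ (X ^ 2) ^ n * a :=
  ((pow_dvd_pow X (by omega : n ≤ 2 * n)).trans (by rw [pow_mul])).mul_right a

theorem one_add_mul_inv {a : ℚ⟦X⟧} (ha : constantCoeff a = 0) : (1 + a) * (1 + a)⁻¹ = 1 :=
  PowerSeries.mul_inv_cancel _ (by simp [ha])

theorem summable_mainSeries (k : ℕ) : Summable fun m : ℕ ↦ (X ^ 2) ^ m *
    (qPoch (X ^ 2) (X ^ 2) m * (qPoch (-X ^ 2) (X ^ 2) m)⁻¹ *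
      (qPoch (-X ^ (2 * k + 1)) (X ^ 2) m)⁻¹) :=
  summable_of_X_pow_dvd fun n ↦ X_pow_dvd_X_sq_pow_mul n _

/-- If `t m` is the `m`-th term of `mainSeries k`, the left side telescopes with `g m = (1 +
q^(2k+1)) (1 + q^(2m)) t m`. The `2` comes from `g 0`, and `mainLimit k` is the limit of `t m`. -/
theorem mainSeries_rec (k : ℕ) :
    (1 + X ^ (2 * k + 1)) * mainSeries k + (X ^ 2 + X ^ (2 * k + 1)) * mainSeries (k + 1) =
      (1 + X ^ (2 * k + 1)) * (2 - mainLimit k) := by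
  have hp : constantCoeff (X ^ 2 : ℚ⟦X⟧) = 0 := by simp
  have hp' : constantCoeff (-X ^ 2 : ℚ⟦X⟧) = 0 := by simp
  have hx : constantCoeff (-X ^ (2 * k + 1) : ℚ⟦X⟧) = 0 := by simp
  have hs := ((summable_mainSeries k).mul_left (1 + X ^ (2 * k + 1))).add
    ((summable_mainSeries (k + 1)).mul_left (X ^ 2 + X ^ (2 * k + 1)))
  have hlim : Tendsto (fun m : ℕ ↦ (1 + X ^ (2 * k + 1)) * ((1 + (X ^ 2) ^ m) *
      (qPoch (X ^ 2) (X ^ 2) m * (qPoch (-X ^ 2) (X ^ 2) m)⁻¹ *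
        (qPoch (-X ^ (2 * k + 1)) (X ^ 2) m)⁻¹)) : ℕ → ℚ⟦X⟧) atTop
      (𝓝 ((1 + X ^ (2 * k + 1)) * ((1 + 0) * mainLimit k))) := by
    refine ((tendsto_const_nhds.add ?_).mul (((tendsto_qPoch _ hp).mul
      (tendsto_inv_qPoch hp' hp)).mul (tendsto_inv_qPoch hx hp))).const_mul _
    exact tendsto_zero_of_X_pow_dvd fun n ↦ by simpa using X_pow_dvd_X_sq_pow_mul n 1
  have htel := tsum_eq_of_telescoping hs (fun m ↦ ?_) hlim
  · rw [Summable.tsum_add ((summable_mainSeries k).mul_left _)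
      ((summable_mainSeries (k + 1)).mul_left _), (summable_mainSeries k).tsum_mul_left,
      (summable_mainSeries (k + 1)).tsum_mul_left] at htel
    rw [mainSeries, mainSeries, htel]
    simp only [qPoch_zero, inv_one, pow_zero]
    ring
  · have h1 := inv_qPoch_eq hp' (X ^ 2) m
    have h2 := inv_qPoch_eq hx (X ^ 2) m
    have h3 := inv_qPoch_mul hx (X ^ 2) m
    rw [neg_X_pow_mul] at h3
    rw [h3, h2, h1, qPoch_succ (X ^ 2) (X ^ 2) m]
    ring

theorem mainLimit_succ (k : ℕ) : mainLimit (k + 1) = (1 + X ^ (2 * k + 1)) * mainLimit k := by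
  have h := inv_qPochInf_mul (a := (-X ^ (2 * k + 1) : ℚ⟦X⟧)) (q := X ^ 2) (by simp) (by simp)
  rw [neg_X_pow_mul] at h
  rw [mainLimit, mainLimit, h]
  ring

theorem summable_lambertSeries (k : ℕ) : Summable fun n : ℕ ↦
    ((-X ^ 2) ^ n * (1 + X ^ (2 * k + 1) * (X ^ 2) ^ n)⁻¹ : ℚ⟦X⟧) :=
  summable_of_X_pow_dvd fun n ↦ by
    rw [neg_pow, mul_comm ((-1) ^ n), mul_assoc]
    exact X_pow_dvd_X_sq_pow_mul n _

theorem lambertSeries_rec (k : ℕ) :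
    lambertSeries k + X ^ 2 * lambertSeries (k + 1) = (1 + X ^ (2 * k + 1))⁻¹ := by
  have h := (summable_lambertSeries k).tsum_eq_zero_add
  have h' : ∀ n : ℕ, ((-X ^ 2) ^ (n + 1) * (1 + X ^ (2 * k + 1) * (X ^ 2) ^ (n + 1))⁻¹ : ℚ⟦X⟧) =
      -X ^ 2 * ((-X ^ 2) ^ n * (1 + X ^ (2 * (k + 1) + 1) * (X ^ 2) ^ n)⁻¹) := fun n ↦ by
    rw [show (X ^ (2 * k + 1) * (X ^ 2) ^ (n + 1) : ℚ⟦X⟧) =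
      X ^ (2 * (k + 1) + 1) * (X ^ 2) ^ n by ring]
    ring
  simp_rw [h'] at h
  rw [(summable_lambertSeries (k + 1)).tsum_mul_left] at h
  rw [lambertSeries, lambertSeries, h]
  simp

theorem summable_mockSeries (k : ℕ) : Summable fun j : ℕ ↦
    ((-1) ^ j * X ^ (2 * k * j + j ^ 2) * (qPoch (-X ^ 2) (X ^ 2) (j + 1))⁻¹ : ℚ⟦X⟧) :=
  summable_of_X_pow_dvd fun n ↦
    ((pow_dvd_pow X (by nlinarith : n ≤ 2 * k * n + n ^ 2)).mul_left _).mul_right _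

/-- The sum telescopes: `g j` is the `j`-th term with the Pochhammer length `j + 1` replaced by `j`,
so `g 0 = 1`. -/
theorem mockSeries_rec (k : ℕ) :
    mockSeries k + (X ^ 2 + X ^ (2 * k + 1)) * mockSeries (k + 1) = 1 := by
  have hs := (summable_mockSeries k).add
    ((summable_mockSeries (k + 1)).mul_left (X ^ 2 + X ^ (2 * k + 1)))
  have hlim : Tendsto (fun j : ℕ ↦ ((-1) ^ j * X ^ (2 * k * j + j ^ 2) *
      (qPoch (-X ^ 2) (X ^ 2) j)⁻¹ : ℚ⟦X⟧)) atTop (𝓝 0) :=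
    tendsto_zero_of_X_pow_dvd fun n ↦
      ((pow_dvd_pow X (by nlinarith : n ≤ 2 * k * n + n ^ 2)).mul_left _).mul_right _
  have htel := tsum_eq_of_telescoping hs (fun j ↦ ?_) hlim
  · rw [Summable.tsum_add (summable_mockSeries k) ((summable_mockSeries (k + 1)).mul_left _),
      (summable_mockSeries (k + 1)).tsum_mul_left] at htel
    rw [mockSeries, mockSeries, htel]
    simp [qPoch_zero]
  · rw [inv_qPoch_eq (by simp) (X ^ 2) j]
    ring

theorem phi3_neg_X : phi3 (-X) = 1 - X * mockSeries 1 := by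
  have hs := summable_phi3 (Q := -X) (by simp)
  rw [phi3, hs.tsum_eq_zero_add, mockSeries, ← (summable_mockSeries 1).tsum_mul_left, sub_eq_add_neg, ← tsum_neg]
  congr 1
  · simp [qPoch_zero]
  · refine tsum_congr fun j ↦ ?_
    rw [neg_sq, neg_pow X, show (-1 : ℚ⟦X⟧) ^ (j + 1) ^ 2 = (-1) ^ (j + 1) by
      rcases Nat.even_or_odd (j + 1) with h | h
      · rw [h.neg_one_pow, (h.pow_of_ne_zero two_ne_zero).neg_one_pow]
      · rw [h.neg_one_pow, h.pow.neg_one_pow]]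
    ring

/-- Both sides satisfy the recurrence `mainSeries_rec`. The index is shifted to `k + 1` because the
Lambert part for `mainSeries 0` would involve `q^(-1)`. -/
theorem mainSeries_succ (k : ℕ) :
    mainSeries (k + 1) =
      2 * (1 + X ^ (2 * k + 1)) * lambertSeries k - mainLimit (k + 1) * mockSeries (k + 1) := by
  set D : ℕ → ℚ⟦X⟧ := fun k ↦ mainSeries (k + 1) -
    (2 * (1 + X ^ (2 * k + 1)) * lambertSeries k - mainLimit (k + 1) * mockSeries (k + 1)) with hD
  have hrec : ∀ k, (1 + X ^ (2 * (k + 1) + 1)) * D k =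
      -(X ^ 2 + X ^ (2 * (k + 1) + 1)) * D (k + 1) := by
    intro k
    have h1 := mainSeries_rec (k + 1)
    have h2 := mainLimit_succ (k + 1)
    have h3 := lambertSeries_rec k
    have h4 := mockSeries_rec (k + 1)
    have h5 := one_add_mul_inv (a := (X ^ (2 * k + 1) : ℚ⟦X⟧)) (by simp)
    simp only [hD]
    rw [h2]
    rw [← h3] at h5
    linear_combination h1 - 2 * (1 + X ^ (2 * (k + 1) + 1)) * h5
      + mainLimit (k + 1) * (1 + X ^ (2 * (k + 1) + 1)) * h4
  -- Uniqueness: the coefficient `X^2 + X^(2k+3)` supplies one factor `X` at each step, for all `k`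
  -- at once, so `D` is divisible by every power of `X`.
  have hdvd : ∀ n k, X ^ n ∣ D k := by
    intro n
    induction n with
    | zero => simp
    | succ n ih =>
      intro k
      have h5 := one_add_mul_inv (a := (X ^ (2 * (k + 1) + 1) : ℚ⟦X⟧)) (by simp)
      obtain ⟨c, hc⟩ := ih (k + 1)
      refine ⟨-(1 + X ^ (2 * (k + 1) + 1))⁻¹ * (X + X ^ (2 * (k + 1))) * c, ?_⟩
      have h6 := hrec k
      rw [hc] at h6
      linear_combination (1 + X ^ (2 * (k + 1) + 1))⁻¹ * h6 - D k * h5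
  exact sub_eq_zero.mp (eq_zero_of_forall_X_pow_dvd fun n ↦ hdvd n k)

theorem qPochInf_X_sq_eq : qPochInf (X ^ 2) (X ^ 2) = qPochInf X X * qPochInf (-X) X :=
  (qPochInf_mul_qPochInf_neg X (by simp)).symm

theorem mainLimit_zero : mainLimit 0 = qPochInf X X := by
  have h1 := qPochInf_X_sq_eq
  have h2 := qPochInf_eq_mul_sq (-X) (q := X) (by simp)
  have h3 := qPochInf_mul_inv (a := -X ^ 2) (q := X ^ 2) (by simp) (by simp)
  have h4 := qPochInf_mul_inv (a := -X) (q := X ^ 2) (by simp) (by simp)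
  rw [show (-X * X : ℚ⟦X⟧) = -X ^ 2 by ring] at h2
  simp only [mainLimit, mul_zero, zero_add, pow_one]
  rw [h1, h2]
  linear_combination qPochInf X X * qPochInf (-X) (X ^ 2) * (qPochInf (-X) (X ^ 2))⁻¹ * h3
    + qPochInf X X * h4

theorem mainSeries_zero :
    mainSeries 0 = 2 - qPochInf X X - X * (2 * (1 + X) * lambertSeries 0)
      + (1 + X) * qPochInf X X * (1 - phi3 (-X)) := by
  have h1 := mainSeries_rec 0
  have h2 := mainSeries_succ 0
  have h3 := mainLimit_succ 0
  have h4 := phi3_neg_X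
  have h5 := one_add_mul_inv (a := (X : ℚ⟦X⟧)) (by simp)
  simp only [mul_zero, zero_add, pow_one] at h1 h2 h3
  rw [mainLimit_zero] at h1 h3
  -- At `k = 0` the coefficient `X^2 + X` is `X (1 + X)`, so `1 + X` cancels throughout.
  have h6 : (1 + X) * (mainSeries 0 + X * mainSeries 1) = (1 + X) * (2 - qPochInf X X) := by
    linear_combination h1
  have h7 : mainSeries 0 + X * mainSeries 1 = 2 - qPochInf X X := by
    linear_combination (1 + X)⁻¹ * h6
      - (mainSeries 0 + X * mainSeries 1 - (2 - qPochInf X X)) * h5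
  rw [h2, h3] at h7
  linear_combination h7 + (1 + X) * qPochInf X X * h4

end MockSeries

/-! ### The theta square as a Lambert series, through a `₁ψ₁` series. -/

section ThetaSquare

/-- The terms of index `n ≥ 0` of the bilateral series `₁ψ₁(-1; q²b; q², -q)`. -/
noncomputable def psiTerm (b : ℚ⟦X⟧) (n : ℕ) : ℚ⟦X⟧ :=
  (-X) ^ n * qPoch (-1) (X ^ 2) n * (qPoch (b * X ^ 2) (X ^ 2) n)⁻¹

/-- The terms of index `-n ≤ 0` of the bilateral series `₁ψ₁(-1; q²b; q², -q)`. -/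
noncomputable def psiNegTerm (b : ℚ⟦X⟧) (n : ℕ) : ℚ⟦X⟧ :=
  ∏ i ∈ Finset.range n, (-X * ((X ^ 2) ^ i - b) * (1 + (X ^ 2) ^ (i + 1))⁻¹)

/-- The bilateral series `₁ψ₁(-1; q²b; q², -q)`. -/
noncomputable def psiSum (b : ℚ⟦X⟧) : ℚ⟦X⟧ := ∑' n, (psiTerm b n + psiNegTerm b (n + 1))

theorem psiTerm_succ (b : ℚ⟦X⟧) (n : ℕ) :
    psiTerm b (n + 1) * (1 - b * X ^ 2 * (X ^ 2) ^ n) =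
      -X * (1 + (X ^ 2) ^ n) * psiTerm b n := by
  have h := inv_qPoch_eq (a := b * X ^ 2) (by simp) (X ^ 2) n
  rw [psiTerm, psiTerm, h, qPoch_succ (-1)]
  ring

theorem psiTerm_mul_X_sq (b : ℚ⟦X⟧) (n : ℕ) :
    psiTerm (b * X ^ 2) n * (1 - b * X ^ 2 * (X ^ 2) ^ n) = (1 - b * X ^ 2) * psiTerm b n := by
  have h := inv_qPoch_eq (a := b * X ^ 2) (by simp) (X ^ 2) n
  have h' := inv_qPoch_mul (a := b * X ^ 2) (by simp) (X ^ 2) n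
  rw [psiTerm, psiTerm, h, h']
  ring

theorem psiNegTerm_zero (b : ℚ⟦X⟧) : psiNegTerm b 0 = 1 := by simp [psiNegTerm]

theorem psiNegTerm_succ (b : ℚ⟦X⟧) (n : ℕ) :
    psiNegTerm b (n + 1) =
      psiNegTerm b n * (-X * ((X ^ 2) ^ n - b) * (1 + (X ^ 2) ^ (n + 1))⁻¹) := by
  rw [psiNegTerm, Finset.prod_range_succ, psiNegTerm]

/-- With `p = q²`, the factor `p^i - b p` equals `p (p^(i-1) - b)` for `i ≥ 1`, so replacing `b` by
`b p` shifts the product by one and leaves `1 - b p` from `i = 0`. -/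
theorem psiNegTerm_mul_X_sq (b : ℚ⟦X⟧) (n : ℕ) :
    psiNegTerm (b * X ^ 2) (n + 1) =
      psiNegTerm b n * (-X * (X ^ 2) ^ n * (1 - b * X ^ 2) * (1 + (X ^ 2) ^ (n + 1))⁻¹) := by
  induction n with
  | zero => simp [psiNegTerm]
  | succ n ih =>
    rw [psiNegTerm_succ, ih, psiNegTerm_succ b n]
    ring

theorem X_pow_dvd_psiTerm (b : ℚ⟦X⟧) (n : ℕ) : X ^ n ∣ psiTerm b n := by
  rw [psiTerm, neg_pow X, mul_assoc, mul_assoc]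
  exact (dvd_mul_right _ _).mul_left _

theorem X_pow_dvd_psiNegTerm (b : ℚ⟦X⟧) (n : ℕ) : X ^ n ∣ psiNegTerm b n := by
  rw [psiNegTerm, ← Finset.card_range n, ← Finset.prod_const, Finset.card_range]
  exact Finset.prod_dvd_prod_of_dvd _ _ fun i _ ↦
    ⟨-((X ^ 2) ^ i - b) * (1 + (X ^ 2) ^ (i + 1))⁻¹, by ring⟩

theorem summable_psiSum (b : ℚ⟦X⟧) : Summable fun n ↦ psiTerm b n + psiNegTerm b (n + 1) :=
  summable_of_X_pow_dvd fun n ↦ (X_pow_dvd_psiTerm b n).add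
    ((pow_dvd_pow X n.le_succ).trans (X_pow_dvd_psiNegTerm b (n + 1)))

/-- The bilateral sum telescopes in both directions; the boundary terms at index `0` cancel, as both
halves start at `1`. -/
theorem psiSum_rec (b : ℚ⟦X⟧) :
    (1 - b * X ^ 2) * (1 - b * X) * psiSum b = (1 + b * X ^ 2) * psiSum (b * X ^ 2) := by
  have hs := ((summable_psiSum b).mul_left ((1 - b * X ^ 2) * (1 - b * X))).sub
    ((summable_psiSum (b * X ^ 2)).mul_left (1 + b * X ^ 2))
  have hlim : Tendsto (fun n ↦ (1 - b * X ^ 2) * X * b * (psiNegTerm b n - psiTerm b n)) atTop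
      (𝓝 0) := tendsto_zero_of_X_pow_dvd fun n ↦
    ((X_pow_dvd_psiNegTerm b n).sub (X_pow_dvd_psiTerm b n)).mul_left _
  have htel := tsum_eq_of_telescoping hs (fun n ↦ ?_) hlim
  · rw [Summable.tsum_sub ((summable_psiSum b).mul_left _)
      ((summable_psiSum (b * X ^ 2)).mul_left _), (summable_psiSum b).tsum_mul_left,
      (summable_psiSum (b * X ^ 2)).tsum_mul_left] at htel
    have h0 : psiTerm b 0 = 1 := by simp [psiTerm, qPoch_zero]
    rw [h0, psiNegTerm_zero] at htel
    rw [psiSum, psiSum]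
    linear_combination htel
  · have h1 := psiTerm_succ b n
    have h2 := psiTerm_mul_X_sq b n
    have h3 := one_add_mul_inv (a := ((X ^ 2) ^ (n + 1) : ℚ⟦X⟧)) (by simp)
    have h4 := PowerSeries.mul_inv_cancel (1 - b * X ^ 2 * (X ^ 2) ^ n) (by simp)
    rw [psiNegTerm_succ, psiNegTerm_mul_X_sq]
    have hneg : (1 - b * X ^ 2) * (1 - b * X) * (psiNegTerm b n *
          (-X * ((X ^ 2) ^ n - b) * (1 + (X ^ 2) ^ (n + 1))⁻¹)) -
        (1 + b * X ^ 2) * (psiNegTerm b n *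
          (-X * (X ^ 2) ^ n * (1 - b * X ^ 2) * (1 + (X ^ 2) ^ (n + 1))⁻¹)) =
        (1 - b * X ^ 2) * X * b * (psiNegTerm b n - psiNegTerm b n *
          (-X * ((X ^ 2) ^ n - b) * (1 + (X ^ 2) ^ (n + 1))⁻¹)) := by
      linear_combination (1 - b * X ^ 2) * X * b * psiNegTerm b n * h3
    -- The positive half is first proved after multiplication by the denominator `1 - b q^(2n+2)`,
    -- an invertible series.
    have hpos' : (1 - b * X ^ 2 * (X ^ 2) ^ n) * ((1 - b * X ^ 2) * (1 - b * X) * psiTerm b n -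
        (1 + b * X ^ 2) * psiTerm (b * X ^ 2) n) = (1 - b * X ^ 2 * (X ^ 2) ^ n) *
        ((1 - b * X ^ 2) * X * b * (psiTerm b (n + 1) - psiTerm b n)) := by
      linear_combination (-(1 + b * X ^ 2)) * h2 - (1 - b * X ^ 2) * X * b * h1
    have hpos : (1 - b * X ^ 2) * (1 - b * X) * psiTerm b n -
        (1 + b * X ^ 2) * psiTerm (b * X ^ 2) n =
        (1 - b * X ^ 2) * X * b * (psiTerm b (n + 1) - psiTerm b n) := by
      linear_combination (1 - b * X ^ 2 * (X ^ 2) ^ n)⁻¹ * hpos' -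
        ((1 - b * X ^ 2) * (1 - b * X) * psiTerm b n - (1 + b * X ^ 2) * psiTerm (b * X ^ 2) n -
          (1 - b * X ^ 2) * X * b * (psiTerm b (n + 1) - psiTerm b n)) * h4
    linear_combination hpos + hneg

theorem psiSum_iterate (b : ℚ⟦X⟧) (k : ℕ) :
    qPoch (b * X ^ 2) (X ^ 2) k * qPoch (b * X) (X ^ 2) k * psiSum b =
      qPoch (-(b * X ^ 2)) (X ^ 2) k * psiSum (b * (X ^ 2) ^ k) := by
  induction k with
  | zero => simp [qPoch_zero]
  | succ k ih =>
    have h := psiSum_rec (b * (X ^ 2) ^ k)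
    have hb : b * (X ^ 2) ^ (k + 1) = b * (X ^ 2) ^ k * X ^ 2 := by ring
    rw [qPoch_succ, qPoch_succ, qPoch_succ, hb]
    linear_combination (1 - b * X ^ 2 * (X ^ 2) ^ k) * (1 - b * X * (X ^ 2) ^ k) * ih
      + qPoch (-(b * X ^ 2)) (X ^ 2) k * h

theorem dvd_inv_sub_inv {d a b : ℚ⟦X⟧} (ha : constantCoeff a ≠ 0) (hb : constantCoeff b ≠ 0)
    (h : d ∣ a - b) : d ∣ a⁻¹ - b⁻¹ := by
  obtain ⟨c, hc⟩ := h
  have h1 := PowerSeries.mul_inv_cancel a ha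
  have h2 := PowerSeries.mul_inv_cancel b hb
  exact ⟨-c * a⁻¹ * b⁻¹, by linear_combination b⁻¹ * h1 - a⁻¹ * h2 - a⁻¹ * b⁻¹ * hc⟩

theorem dvd_prod_sub_prod {d : ℚ⟦X⟧} {f g : ℕ → ℚ⟦X⟧} (n : ℕ) (h : ∀ i, d ∣ f i - g i) :
    d ∣ ∏ i ∈ Finset.range n, f i - ∏ i ∈ Finset.range n, g i := by
  induction n with
  | zero => simp
  | succ n ih =>
    rw [Finset.prod_range_succ, Finset.prod_range_succ]
    obtain ⟨c, hc⟩ := ih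
    obtain ⟨e, he⟩ := h n
    exact ⟨c * f n + (∏ i ∈ Finset.range n, g i) * e, by
      linear_combination f n * hc + (∏ i ∈ Finset.range n, g i) * he⟩

/-- This is continuity of `psiSum` in `b`, needed to let `b q^(2k)` tend to `0`. -/
theorem X_pow_dvd_psiSum_sub {b c : ℚ⟦X⟧} {N : ℕ} (h : X ^ N ∣ b - c) :
    X ^ N ∣ psiSum b - psiSum c := by
  rw [psiSum, psiSum, ← (summable_psiSum b).tsum_sub (summable_psiSum c)]
  refine X_pow_dvd_tsum fun n ↦ ?_
  rw [add_sub_add_comm]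
  refine dvd_add ?_ (dvd_prod_sub_prod _ fun i ↦ ?_)
  · rw [psiTerm, psiTerm, ← mul_sub]
    refine (dvd_inv_sub_inv (by simp [map_prod]) (by simp [map_prod])
      (dvd_prod_sub_prod _ fun i ↦ ?_)).mul_left _
    exact (h.mul_right (-X ^ 2 * (X ^ 2) ^ i)).trans (dvd_of_eq (by ring))
  · exact (h.mul_right (X * (1 + (X ^ 2) ^ (i + 1))⁻¹)).trans (dvd_of_eq (by ring))

/-- Iterating the functional equation sends both `b = 1` and `b = -1` to `b = 0`; eliminating the
common limit `psiSum 0` relates the two values. -/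
theorem psiSum_one_relation :
    qPochInf (X ^ 2) (X ^ 2) ^ 2 * qPochInf X (X ^ 2) * psiSum 1 =
      qPochInf (-X ^ 2) (X ^ 2) ^ 2 * qPochInf (-X) (X ^ 2) * psiSum (-1) := by
  have hq : constantCoeff (X ^ 2 : ℚ⟦X⟧) = 0 := by simp
  have h0 : Tendsto (fun k : ℕ ↦ qPoch (X ^ 2) (X ^ 2) k * qPoch (-X ^ 2) (X ^ 2) k *
      (psiSum (1 * (X ^ 2) ^ k) - psiSum (-1 * (X ^ 2) ^ k))) atTop (𝓝 0) := by
    refine tendsto_zero_of_X_pow_dvd fun k ↦ (X_pow_dvd_psiSum_sub ?_).mul_left _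
    exact (X_pow_dvd_X_sq_pow_mul k 2).trans (dvd_of_eq (by ring))
  have h1 : Tendsto (fun k : ℕ ↦
      qPoch (X ^ 2) (X ^ 2) k ^ 2 * qPoch X (X ^ 2) k * psiSum 1 -
      qPoch (-X ^ 2) (X ^ 2) k ^ 2 * qPoch (-X) (X ^ 2) k * psiSum (-1)) atTop
      (𝓝 (qPochInf (X ^ 2) (X ^ 2) ^ 2 * qPochInf X (X ^ 2) * psiSum 1 -
      qPochInf (-X ^ 2) (X ^ 2) ^ 2 * qPochInf (-X) (X ^ 2) * psiSum (-1))) :=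
    ((((tendsto_qPoch _ hq).pow 2).mul (tendsto_qPoch _ hq)).mul_const _).sub
      ((((tendsto_qPoch _ hq).pow 2).mul (tendsto_qPoch _ hq)).mul_const _)
  refine sub_eq_zero.mp (tendsto_nhds_unique h1 (h0.congr fun k ↦ ?_))
  have h2 := psiSum_iterate 1 k
  have h3 := psiSum_iterate (-1) k
  simp only [one_mul, neg_mul, neg_neg] at h2 h3 ⊢
  linear_combination -qPoch (X ^ 2) (X ^ 2) k * h2 + qPoch (-X ^ 2) (X ^ 2) k * h3

theorem psiNegTerm_one_succ (n : ℕ) : psiNegTerm 1 (n + 1) = 0 :=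
  Finset.prod_eq_zero (Finset.mem_range.mpr n.succ_pos) (by simp)

/-- `∑ₙ (-1; q²)ₙ / (q²; q²)ₙ (-q^(2k+1))^n`. -/
noncomputable def binomialSeries (k : ℕ) : ℚ⟦X⟧ := ∑' n : ℕ, psiTerm 1 n * (X ^ (2 * k)) ^ n

theorem summable_binomialSeries (k : ℕ) :
    Summable fun n : ℕ ↦ psiTerm 1 n * (X ^ (2 * k)) ^ n :=
  summable_of_X_pow_dvd fun n ↦ (X_pow_dvd_psiTerm 1 n).mul_right _

/-- This is the functional equation behind the `q`-binomial theorem. Iterating it sends the argument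
`-q^(2k+1)` to `0`, where the series is `1`. -/
theorem binomialSeries_rec (k : ℕ) :
    (1 + X ^ (2 * k + 1)) * binomialSeries k =
      (1 - X ^ (2 * k + 1)) * binomialSeries (k + 1) := by
  have hs := ((summable_binomialSeries k).mul_left (1 + X ^ (2 * k + 1))).sub
    ((summable_binomialSeries (k + 1)).mul_left (1 - X ^ (2 * k + 1)))
  have hlim : Tendsto (fun n : ℕ ↦
      psiTerm 1 n * (X ^ (2 * k)) ^ n * (1 - (X ^ 2) ^ n)) atTop (𝓝 0) :=
    tendsto_zero_of_X_pow_dvd fun n ↦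
      ((X_pow_dvd_psiTerm 1 n).mul_right _).mul_right _
  have htel := tsum_eq_of_telescoping hs (fun n ↦ ?_) hlim
  · rw [Summable.tsum_sub ((summable_binomialSeries k).mul_left _)
      ((summable_binomialSeries (k + 1)).mul_left _),
      (summable_binomialSeries k).tsum_mul_left,
      (summable_binomialSeries (k + 1)).tsum_mul_left] at htel
    rw [binomialSeries, binomialSeries]
    linear_combination htel
  · have h := psiTerm_succ 1 n
    linear_combination (X ^ (2 * k)) ^ (n + 1) * h

theorem binomialSeries_zero :
    qPochInf (-X) (X ^ 2) * binomialSeries 0 = qPochInf X (X ^ 2) := by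
  have hq : constantCoeff (X ^ 2 : ℚ⟦X⟧) = 0 := by simp
  have hrec : ∀ k, qPoch (-X) (X ^ 2) k * binomialSeries 0 =
      qPoch X (X ^ 2) k * binomialSeries k := by
    intro k
    induction k with
    | zero => simp [qPoch_zero]
    | succ k ih =>
      have h := binomialSeries_rec k
      rw [qPoch_succ, qPoch_succ]
      linear_combination (1 + X * (X ^ 2) ^ k) * ih + qPoch X (X ^ 2) k * h
  have hone : Tendsto binomialSeries atTop (𝓝 1) := by
    have : Tendsto (fun k ↦ binomialSeries k - 1) atTop (𝓝 0) := by
      refine tendsto_zero_of_X_pow_dvd fun k ↦ ?_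
      rw [binomialSeries, (summable_binomialSeries k).tsum_eq_zero_add]
      rw [show psiTerm 1 0 * (X ^ (2 * k)) ^ 0 = 1 by simp [psiTerm, qPoch_zero],
        add_sub_cancel_left]
      refine X_pow_dvd_tsum fun n ↦ ?_
      rw [← pow_mul]
      exact (pow_dvd_pow X (by nlinarith)).mul_left _
    simpa using this.add_const 1
  refine tendsto_nhds_unique ((tendsto_qPoch (-X) hq).mul_const _) ?_
  simp_rw [hrec]
  simpa using (tendsto_qPoch X hq).mul hone

theorem psiSum_one : psiSum 1 = binomialSeries 0 := by
  rw [psiSum, binomialSeries]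
  exact tsum_congr fun n ↦ by simp [psiNegTerm_one_succ]

theorem psiTerm_neg_one_succ (n : ℕ) :
    psiTerm (-1) (n + 1) = 2 * (-X) ^ (n + 1) * (1 + (X ^ 2) ^ (n + 1))⁻¹ := by
  have h1 := qPoch_succ' (-1) (X ^ 2) n
  have h2 := qPoch_succ (-1 * X ^ 2 : ℚ⟦X⟧) (X ^ 2) n
  have h3 := qPoch_mul_inv (a := (-1 * X ^ 2 : ℚ⟦X⟧)) (by simp) (X ^ 2) (n + 1)
  have h4 := one_add_mul_inv (a := ((X ^ 2) ^ (n + 1) : ℚ⟦X⟧)) (by simp)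
  rw [psiTerm, h1]
  rw [h2] at h3 ⊢
  generalize (qPoch (-1 * X ^ 2) (X ^ 2) n * (1 - -1 * X ^ 2 * (X ^ 2) ^ n) : ℚ⟦X⟧)⁻¹ = A at *
  linear_combination 2 * (-X) ^ (n + 1) * (1 + (X ^ 2) ^ (n + 1))⁻¹ * h3
    - 2 * (-X) ^ (n + 1) * A * qPoch (-1 * X ^ 2) (X ^ 2) n * h4

theorem psiNegTerm_neg_one_succ (n : ℕ) :
    psiNegTerm (-1) (n + 1) = 2 * (-X) ^ (n + 1) * (1 + (X ^ 2) ^ (n + 1))⁻¹ := by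
  induction n with
  | zero =>
    rw [psiNegTerm_succ, psiNegTerm_zero]
    ring
  | succ n ih =>
    have h4 := one_add_mul_inv (a := ((X ^ 2) ^ (n + 1) : ℚ⟦X⟧)) (by simp)
    rw [psiNegTerm_succ, ih]
    linear_combination 2 * (-X) ^ (n + 2) * (1 + (X ^ 2) ^ (n + 1 + 1))⁻¹ * h4

theorem inv_one_add_eq_tsum {y : ℚ⟦X⟧} (hy : constantCoeff y = 0) :
    (1 + y)⁻¹ = ∑' n : ℕ, (-y) ^ n := by
  rw [PowerSeries.inv_eq_iff_mul_eq_one (by simp [hy])]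
  simpa using WithPiTopology.tsum_pow_mul_one_sub_of_constantCoeff_eq_zero
    (f := -y) (by simp [hy])

theorem summable_neg_one_pow_mul_X_pow : Summable (Function.uncurry fun j n : ℕ ↦
    ((-1) ^ (j + n + 1) * X ^ ((2 * n + 1) * (j + 1)) : ℚ⟦X⟧)) := by
  rw [WithPiTopology.summable_iff_summable_coeff]
  intro d
  refine summable_of_ne_finset_zero
    (s := (Finset.range (d + 1)) ×ˢ (Finset.range (d + 1))) fun x hx ↦ ?_
  have hlt : d < (2 * x.2 + 1) * (x.1 + 1) := by
    by_contra hle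
    refine hx ?_
    simp only [Finset.mem_product, Finset.mem_range]
    constructor <;> nlinarith
  exact X_pow_dvd_iff.mp (dvd_mul_left _ _) d hlt

theorem mul_inv_one_add_eq_tsum (c : ℚ⟦X⟧) {y : ℚ⟦X⟧} (hy : constantCoeff y = 0) :
    c * (1 + y)⁻¹ = ∑' n : ℕ, c * (-y) ^ n := by
  rw [inv_one_add_eq_tsum hy, Summable.tsum_mul_left]
  exact WithPiTopology.summable_pow_of_constantCoeff_eq_zero (by simp [hy])

/-- Expanding each denominator geometrically gives the same double series of `(-1)^(j+n+1)
q^((2n+1)(j+1))`, summed in the two orders. -/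
theorem tsum_neg_X_pow_eq :
    ∑' n : ℕ, (-X) ^ (n + 1) * (1 + (X ^ 2) ^ (n + 1))⁻¹ = -X * lambertSeries 0 := by
  have h1 : ∀ j : ℕ, ((-X) ^ (j + 1) * (1 + (X ^ 2) ^ (j + 1))⁻¹ : ℚ⟦X⟧) =
      ∑' n : ℕ, (-1) ^ (j + n + 1) * X ^ ((2 * n + 1) * (j + 1)) := by
    intro j
    rw [mul_inv_one_add_eq_tsum _ (by simp)]
    refine tsum_congr fun n ↦ ?_
    rw [neg_pow X, neg_pow ((X ^ 2) ^ (j + 1) : ℚ⟦X⟧)]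
    ring
  have h2 : ∀ n : ℕ, -X * ((-X ^ 2) ^ n * (1 + X ^ (2 * 0 + 1) * (X ^ 2) ^ n)⁻¹ : ℚ⟦X⟧) =
      ∑' j : ℕ, (-1) ^ (j + n + 1) * X ^ ((2 * n + 1) * (j + 1)) := by
    intro n
    rw [← mul_assoc, mul_inv_one_add_eq_tsum _ (by simp)]
    refine tsum_congr fun j ↦ ?_
    rw [neg_pow (X ^ 2 : ℚ⟦X⟧), neg_pow (X ^ (2 * 0 + 1) * (X ^ 2) ^ n : ℚ⟦X⟧)]
    ring
  have hsum := summable_neg_one_pow_mul_X_pow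
  rw [lambertSeries, ← (summable_lambertSeries 0).tsum_mul_left, tsum_congr h1, tsum_congr h2]
  refine (hsum.tsum_comm' (fun j ↦ ?_) (fun n ↦ ?_)).symm
  · exact summable_of_X_pow_dvd fun n ↦ (pow_dvd_pow X (by nlinarith)).mul_left _
  · exact summable_of_X_pow_dvd fun j ↦ (pow_dvd_pow X (by nlinarith)).mul_left _

theorem psiSum_neg_one : psiSum (-1) = 1 - 4 * X * lambertSeries 0 := by
  have hs : Summable (psiTerm (-1)) := summable_of_X_pow_dvd (X_pow_dvd_psiTerm _)
  have hs' : Summable fun n ↦ psiNegTerm (-1) (n + 1) := summable_of_X_pow_dvd fun n ↦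
    (pow_dvd_pow X n.le_succ).trans (X_pow_dvd_psiNegTerm (-1) (n + 1))
  have hs'' : Summable fun n : ℕ ↦ ((-X) ^ (n + 1) * (1 + (X ^ 2) ^ (n + 1))⁻¹ : ℚ⟦X⟧) :=
    summable_of_X_pow_dvd fun n ↦ by
      rw [neg_pow, pow_succ X, mul_assoc, mul_assoc]
      exact (dvd_mul_right _ _).mul_left _
  rw [psiSum, hs.tsum_add hs', hs.tsum_eq_zero_add]
  simp_rw [psiTerm_neg_one_succ, psiNegTerm_neg_one_succ, mul_assoc]
  rw [hs''.tsum_mul_left, tsum_neg_X_pow_eq]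
  simp only [psiTerm, qPoch_zero]
  simp
  ring

/-- The square of `∑ₙ (-1)^n q^(n²) = (q; q)_∞ / (-q; q)_∞` as a Lambert series. -/
theorem qPochInf_sq_eq_lambertSeries :
    qPochInf X X ^ 2 = qPochInf (-X) X ^ 2 * (1 - 4 * X * lambertSeries 0) := by
  have h1 := psiSum_one_relation
  have h2 := binomialSeries_zero
  have h3 := qPochInf_eq_mul_sq X (q := X) (by simp)
  have h4 := qPochInf_eq_mul_sq (-X) (q := X) (by simp)
  rw [show (-X * X : ℚ⟦X⟧) = -X ^ 2 by ring] at h4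
  rw [← pow_two] at h3
  rw [psiSum_one, psiSum_neg_one] at h1
  rw [h3, h4]
  linear_combination qPochInf (-X) (X ^ 2) * h1 -
    qPochInf (X ^ 2) (X ^ 2) ^ 2 * qPochInf X (X ^ 2) * h2

end ThetaSquare

/-! ### Counting admissible partitions and assembling the identity. -/

section GeneratingFunction

/-- The generating function of the partitions all of whose parts satisfy `P`. -/
noncomputable def restrictedSeries (P : ℕ → Prop) [DecidablePred P] : ℚ⟦X⟧ :=
  PowerSeries.mk fun n ↦ ((Nat.Partition.restricted n P).card : ℚ)

theorem restrictedSeries_mul {P : ℕ → Prop} [DecidablePred P] {c : ℚ⟦X⟧}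
    (h : HasProd (fun i ↦ if P (i + 1) then (1 - X ^ (i + 1) : ℚ⟦X⟧) else 1) c) :
    restrictedSeries P * c = 1 := by
  have h1 := (Nat.Partition.hasProd_powerSeriesMk_card_restricted ℚ P).mul h
  refine h1.unique ?_
  convert! hasProd_one (α := ℚ⟦X⟧) (β := ℕ) using 2 with i
  split_ifs
  · simp_rw [pow_mul]
    exact WithPiTopology.tsum_pow_mul_one_sub_of_constantCoeff_eq_zero (by simp)
  · simp

theorem qPoch_add (a q : ℚ⟦X⟧) (m n : ℕ) :
    qPoch a q (m + n) = qPoch a q m * qPoch (a * q ^ m) q n := by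
  simp only [qPoch, Finset.prod_range_add, pow_add, mul_assoc]

theorem hasProd_qPochInf (a : ℚ⟦X⟧) {q : ℚ⟦X⟧} (hq : constantCoeff q = 0) :
    HasProd (fun k : ℕ ↦ 1 - a * q ^ k) (qPochInf a q) :=
  (multipliable_qPochInf a hq).hasProd

theorem restrictedSeries_le_mul (s : ℕ) :
    restrictedSeries (s + 1 ≤ ·) * qPochInf X X = qPoch X X s := by
  have h1 := Nat.Partition.hasProd_powerSeriesMk_card_restricted ℚ (s + 1 ≤ ·)
  have h2 := h1.mul (hasProd_qPochInf X (q := X) (by simp))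
  have h3 : HasProd (fun k : ℕ ↦ if k < s then (1 - X * X ^ k : ℚ⟦X⟧) else 1)
      (∏ k ∈ Finset.range s, if k < s then (1 - X * X ^ k : ℚ⟦X⟧) else 1) :=
    hasProd_prod_of_ne_finset_one fun k hk ↦ if_neg (by simpa using hk)
  have h4 : ∏ k ∈ Finset.range s, (if k < s then (1 - X * X ^ k : ℚ⟦X⟧) else 1) =
      qPoch X X s := Finset.prod_congr rfl fun k hk ↦ if_pos (Finset.mem_range.mp hk)
  rw [h4] at h3
  refine h2.unique ?_
  convert! h3 using 2 with i
  -- Index `i` stands for part size `i + 1`: allowed parts cancel their factor of `(q;q)_∞`, and the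
  -- first `s` factors survive.
  by_cases h : i < s
  · rw [if_pos h, if_neg (by omega), one_mul]
  · rw [if_neg h, if_pos (by omega)]
    simp_rw [pow_mul, ← pow_succ']
    exact WithPiTopology.tsum_pow_mul_one_sub_of_constantCoeff_eq_zero (by simp)

/-- Partitions into even parts in `(2m, 4m]`. -/
theorem restrictedSeries_even_mul (m : ℕ) :
    restrictedSeries (fun x ↦ Even x ∧ x ∈ Set.Ioc (2 * m) (4 * m)) *
      qPoch (X ^ 2 * (X ^ 2) ^ m) (X ^ 2) m = 1 := by
  refine restrictedSeries_mul ?_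
  have h : HasProd
      (fun i ↦ if Even (i + 1) ∧ i + 1 ∈ Set.Ioc (2 * m) (4 * m) then
        (1 - X ^ (i + 1) : ℚ⟦X⟧) else 1)
      (∏ i ∈ (Finset.range m).image (fun j ↦ 2 * (m + j) + 1),
        if Even (i + 1) ∧ i + 1 ∈ Set.Ioc (2 * m) (4 * m) then
          (1 - X ^ (i + 1) : ℚ⟦X⟧) else 1) := by
    refine hasProd_prod_of_ne_finset_one fun i hi ↦ if_neg ?_
    rintro ⟨⟨j, hj⟩, h1, h2⟩
    refine hi (Finset.mem_image.mpr ⟨j - (m + 1), ?_, ?_⟩)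
    · rw [Finset.mem_range]
      omega
    · omega
  convert! h using 1
  rw [Finset.prod_image (fun a _ b _ hab ↦ by simpa using hab), qPoch]
  refine Finset.prod_congr rfl fun j hj ↦ ?_
  rw [Finset.mem_range] at hj
  rw [if_pos ⟨⟨m + j + 1, by ring⟩, by constructor <;> omega⟩]
  ring

/-- The number of partitions of `n` with smallest part `a`. -/
theorem card_partition_smallest {a : ℕ} (ha : 1 ≤ a) (n : ℕ) :
    (Nat.card {p : n.Partition // a ∈ p.parts ∧ ∀ x ∈ p.parts, a ≤ x} : ℚ) =
      coeff n (X ^ a * restrictedSeries (a ≤ ·)) := by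
  rw [coeff_X_pow_mul']
  split_ifs with h
  · rw [restrictedSeries, coeff_mk, Nat.cast_inj, ← Nat.card_eq_finsetCard]
    refine Nat.card_congr ?_
    refine (Equiv.subtypeSubtypeEquivSubtypeInter (fun p : n.Partition ↦ a ∈ p.parts)
      (fun p ↦ ∀ x ∈ p.parts, a ≤ x)).symm.trans ?_
    -- Removing one copy of `a` is the bijection; further copies of `a` may remain, so the bound
    -- stays `a ≤ x`.
    refine ((Nat.Partition.partitionWithPartEquiv ha h).subtypeEquiv
      (q := fun p ↦ p ∈ Nat.Partition.restricted (n - a) (a ≤ ·)) fun p ↦ ?_)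
    simp only [Nat.Partition.restricted, Finset.mem_filter, Finset.mem_univ, true_and,
      Nat.Partition.partitionWithPartEquiv_apply_parts]
    refine ⟨fun hp x hx ↦ hp x (Multiset.mem_of_mem_erase hx), fun hp x hx ↦ ?_⟩
    by_cases hxa : x = a
    · exact hxa.ge
    · exact hp x ((Multiset.mem_erase_of_ne hxa).mpr hx)
  · have : IsEmpty {p : n.Partition // a ∈ p.parts ∧ ∀ x ∈ p.parts, a ≤ x} :=
      ⟨fun p ↦ h (p.1.le_of_mem_parts p.2.1)⟩
    simp

/-- Admissibility with prescribed smallest part `2m + 1`. -/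
def IsAdmissibleWith (m : ℕ) {n : ℕ} (p : TwoColorPartition n) : Prop :=
  IsSmallestPart p (2 * m + 1) ∧ ∀ x ∈ redParts p, Even x ∧ x ∈ Set.Ioc (2 * m) (4 * m)

theorem isAdmissibleWith_iff (m : ℕ) {n : ℕ} (p : TwoColorPartition n) :
    IsAdmissibleWith m p ↔
      (∀ x ∈ redParts p, Even x ∧ x ∈ Set.Ioc (2 * m) (4 * m)) ∧
        (2 * m + 1 ∈ blueParts p ∧ ∀ x ∈ blueParts p, 2 * m + 1 ≤ x) := by
  constructor
  · rintro ⟨⟨h1, h2⟩, h3⟩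
    refine ⟨h3, ?_, fun x hx ↦ h2 x (Multiset.mem_add.mpr (Or.inr hx))⟩
    refine (Multiset.mem_add.mp h1).resolve_left fun h ↦ ?_
    exact absurd (h3 _ h).1 (by simp)
  · rintro ⟨h1, h2, h3⟩
    refine ⟨⟨Multiset.mem_add.mpr (Or.inr h2), fun x hx ↦ ?_⟩, h1⟩
    exact (Multiset.mem_add.mp hx).elim (fun h ↦ (h1 x h).2.1) (h3 x)

theorem IsAdmissibleWith.unique {m m' n : ℕ} {p : TwoColorPartition n}
    (h : IsAdmissibleWith m p) (h' : IsAdmissibleWith m' p) : m = m' := by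
  have h1 := h.1.2 _ h'.1.1
  have h2 := h'.1.2 _ h.1.1
  omega

theorem IsAdmissibleWith.lt {m n : ℕ} {p : TwoColorPartition n} (h : IsAdmissibleWith m p) :
    m < n := by
  have h1 := Nat.Partition.le_of_mem_parts ((isAdmissibleWith_iff m p).mp h).2.1
  have h2 := Finset.HasAntidiagonal.mem_antidiagonal.mp p.1.2
  omega

/-- The generating function of the admissible two-color partitions with smallest part `2m + 1`. -/
noncomputable def admissibleSeries (m : ℕ) : ℚ⟦X⟧ :=
  restrictedSeries (fun x ↦ Even x ∧ x ∈ Set.Ioc (2 * m) (4 * m)) *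
    (X ^ (2 * m + 1) * restrictedSeries (2 * m + 1 ≤ ·))

theorem card_isAdmissibleWith (m n : ℕ) :
    (Nat.card {p : TwoColorPartition n // IsAdmissibleWith m p} : ℚ) =
      coeff n (admissibleSeries m) := by
  have e : {p : TwoColorPartition n // IsAdmissibleWith m p} ≃
      Σ kl : {kl : ℕ × ℕ // kl ∈ Finset.HasAntidiagonal.antidiagonal n},
        {r : kl.1.1.Partition // ∀ x ∈ r.parts, Even x ∧ x ∈ Set.Ioc (2 * m) (4 * m)} ×
        {b : kl.1.2.Partition // 2 * m + 1 ∈ b.parts ∧ ∀ x ∈ b.parts, 2 * m + 1 ≤ x} := by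
    refine (Equiv.subtypeEquivRight fun p ↦ isAdmissibleWith_iff m p).trans ?_
    exact ⟨fun x ↦ ⟨x.1.1, ⟨x.1.2.1, x.2.1⟩, ⟨x.1.2.2, x.2.2⟩⟩,
      fun x ↦ ⟨⟨x.1, x.2.1.1, x.2.2.1⟩, x.2.1.2, x.2.2.2⟩, fun _ ↦ rfl, fun _ ↦ rfl⟩
  have hred : ∀ k, (Nat.card {r : k.Partition // ∀ x ∈ r.parts,
      Even x ∧ x ∈ Set.Ioc (2 * m) (4 * m)} : ℚ) =
      coeff k (restrictedSeries fun x ↦ Even x ∧ x ∈ Set.Ioc (2 * m) (4 * m)) := fun k ↦ by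
    rw [restrictedSeries, coeff_mk, Nat.cast_inj, ← Nat.card_eq_finsetCard]
    exact Nat.card_congr (Equiv.subtypeEquivRight fun r ↦ by simp [Nat.Partition.restricted])
  rw [Nat.card_congr e, Nat.card_sigma, admissibleSeries, coeff_mul, Nat.cast_sum]
  refine Eq.trans ?_ (Finset.sum_coe_sort (Finset.HasAntidiagonal.antidiagonal n)
    fun kl : ℕ × ℕ ↦
      coeff kl.1 (restrictedSeries fun x ↦ Even x ∧ x ∈ Set.Ioc (2 * m) (4 * m)) *
        coeff kl.2 (X ^ (2 * m + 1) * restrictedSeries (2 * m + 1 ≤ ·)))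
  refine Finset.sum_congr rfl fun kl _ ↦ ?_
  rw [Nat.card_prod, Nat.cast_mul, hred, card_partition_smallest (by omega)]

/-- The smallest part determines `m`, and `2m + 1 ≤ n` forces `m < n`, so each coefficient is a
finite disjoint count. -/
theorem hasSum_admissibleSeries :
    HasSum admissibleSeries (PowerSeries.mk fun n ↦ (G' n : ℚ)) := by
  rw [WithPiTopology.hasSum_iff_hasSum_coeff]
  intro n
  have h : coeff n (PowerSeries.mk fun n ↦ (G' n : ℚ)) =
      ∑ m ∈ Finset.range n, coeff n (admissibleSeries m) := by
    simp_rw [← card_isAdmissibleWith]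
    have e : (Σ m : Fin n, {p : TwoColorPartition n // IsAdmissibleWith m p}) ≃
        {p : TwoColorPartition n // IsAdmissible p} := by
      refine Equiv.ofBijective (fun x ↦ ⟨x.2.1, x.1, x.2.2⟩) ⟨?_, ?_⟩
      · rintro ⟨m, p, hp⟩ ⟨m', p', hp'⟩ h
        obtain rfl : p = p' := congrArg Subtype.val h
        obtain rfl : m = m' := Fin.ext (hp.unique hp')
        rfl
      · rintro ⟨p, m, hp⟩
        have hp : IsAdmissibleWith m p := hp
        exact ⟨⟨⟨m, hp.lt⟩, p, hp⟩, rfl⟩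
    rw [coeff_mk, G', ← Nat.card_congr e, Nat.card_sigma, Nat.cast_sum,
      Finset.sum_range fun m ↦
        (Nat.card {p : TwoColorPartition n // IsAdmissibleWith m p} : ℚ)]
  rw [h]
  refine hasSum_sum_of_ne_finset_zero fun m hm ↦ ?_
  rw [← card_isAdmissibleWith]
  have : IsEmpty {p : TwoColorPartition n // IsAdmissibleWith m p} :=
    ⟨fun p ↦ hm (Finset.mem_range.mpr p.2.lt)⟩
  simp

/-- The blue parts contribute `(q;q)_(2m)` and the red ones `(q²;q²)_m / (q²;q²)_(2m)`. Splitting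
both symbols of length `2m` by parity of the exponent index, and using `(a;q)_m (-a;q)_m =
(a²;q²)_m`, leaves the stated quotient. -/
theorem admissibleSeries_mul (m : ℕ) :
    admissibleSeries m * qPochInf X X = X * ((X ^ 2) ^ m * (qPoch (X ^ 2) (X ^ 2) m *
      (qPoch (-X ^ 2) (X ^ 2) m)⁻¹ * (qPoch (-X ^ (2 * 0 + 1)) (X ^ 2) m)⁻¹)) := by
  have h1 := restrictedSeries_le_mul (2 * m)
  have h2 := restrictedSeries_even_mul m
  have h3 := qPoch_two_mul X X m
  have h4 := qPoch_mul_inv (a := -X ^ 2) (by simp) (X ^ 2) m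
  have h5 := qPoch_mul_inv (a := -X) (by simp) (X ^ 2) m
  have h6 := qPoch_add (X ^ 2) (X ^ 2) m m
  have h7 := qPoch_two_mul (X ^ 2) (X ^ 2) m
  have h8 := qPoch_mul_qPoch_neg X (X ^ 2) m
  have h9 := qPoch_mul_qPoch_neg (X ^ 2) (X ^ 2) m
  rw [← two_mul, h7, ← pow_two, ← h8, ← h9] at h6
  rw [← pow_two] at h3
  rw [h3] at h1
  rw [admissibleSeries]
  simp only [mul_zero, zero_add, pow_one]
  generalize restrictedSeries (2 * m + 1 ≤ ·) = b at *
  generalize restrictedSeries (fun x ↦ Even x ∧ x ∈ Set.Ioc (2 * m) (4 * m)) = r at *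
  generalize (qPoch (-X ^ 2) (X ^ 2) m)⁻¹ = c at *
  generalize (qPoch (-X) (X ^ 2) m)⁻¹ = d at *
  have h10 : r * qPoch X (X ^ 2) m * qPoch (X ^ 2) (X ^ 2) m =
      qPoch (X ^ 2) (X ^ 2) m * c * d := by
    linear_combination (-(r * qPoch X (X ^ 2) m * qPoch (X ^ 2) (X ^ 2) m)) * h4
      - r * qPoch X (X ^ 2) m * qPoch (X ^ 2) (X ^ 2) m * qPoch (-X ^ 2) (X ^ 2) m * c * h5
      + qPoch (X ^ 2) (X ^ 2) m * c * d * h2 + r * c * d * h6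
  linear_combination r * X ^ (2 * m + 1) * h1 + X ^ (2 * m + 1) * h10

theorem mk_G'_mul : (PowerSeries.mk fun n ↦ (G' n : ℚ)) * qPochInf X X = X * mainSeries 0 := by
  have h := hasSum_admissibleSeries.mul_right (qPochInf X X)
  simp_rw [admissibleSeries_mul] at h
  exact h.unique ((summable_mainSeries 0).hasSum.mul_left X)

theorem mk_G'_eq :
    (PowerSeries.mk fun n ↦ (G' n : ℚ)) =
      X ^ 2 - X * (1 + X) * phi3 (-X)
        + X * (3 - X) * (2 * qPochInf X X)⁻¹
        + X * (1 + X) * qPochInf (X ^ 2) (X ^ 2)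
            * (2 * qPochInf (-X) X ^ 3)⁻¹ := by
  have h0 := mk_G'_mul
  have h1 := mainSeries_zero
  have h2 := qPochInf_sq_eq_lambertSeries
  have h3 := qPochInf_X_sq_eq
  have hA := constantCoeff_qPochInf (a := X) (q := X) (by simp) (by simp)
  have hB := constantCoeff_qPochInf (a := -X) (q := X) (by simp) (by simp)
  have h2' : constantCoeff (2 : ℚ⟦X⟧) = 2 := map_ofNat _ 2
  have h4 : (2 * qPochInf X X) * (2 * qPochInf X X)⁻¹ = 1 :=
    PowerSeries.mul_inv_cancel _ (by simp [hA, h2'])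
  have h5 : (2 * qPochInf (-X) X ^ 3) * (2 * qPochInf (-X) X ^ 3)⁻¹ = 1 :=
    PowerSeries.mul_inv_cancel _ (by simp [hB, h2'])
  rw [h1] at h0
  rw [h3]
  generalize PowerSeries.mk (fun n ↦ (G' n : ℚ)) = S at *
  generalize qPochInf X X = A at *
  generalize qPochInf (-X) X = B at *
  generalize (2 * A)⁻¹ = A' at *
  generalize (2 * B ^ 3)⁻¹ = B' at *
  -- Here `A` and `B` are `(q;q)_∞` and `(-q;q)_∞`. The Lambert term is replaced using `A² = B² (1 -
  -- 4q * lambertSeries 0)`, and the invertible factor `2 * A` is cancelled at the end.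
  have h6 : 2 * A * (S - (X ^ 2 - X * (1 + X) * phi3 (-X) + X * (3 - X) * A' +
      X * (1 + X) * (A * B) * B')) = 0 := by
    linear_combination 2 * h0 - X * (3 - X) * h4 - 2 * X * (1 + X) * B * B' * h2
      - X * (1 + X) * (1 - 4 * X * lambertSeries 0) * h5
  refine sub_eq_zero.mp ?_
  generalize S - (X ^ 2 - X * (1 + X) * phi3 (-X) + X * (3 - X) * A' +
      X * (1 + X) * (A * B) * B') = T at *
  linear_combination A' * h6 - T * h4

end GeneratingFunction

end TwoColor

theorem theorem6p1 :
    (PowerSeries.mk fun n ↦ (TwoColor.G' n : ℚ)) =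
      X ^ 2 - X * (1 + X) * TwoColor.phi3 (-X)
        + X * (3 - X) * (2 * TwoColor.qPochInf X X)⁻¹
        + X * (1 + X) * TwoColor.qPochInf (X ^ 2) (X ^ 2)
            * (2 * TwoColor.qPochInf (-X) X ^ 3)⁻¹ := by
  exact TwoColor.mk_G'_eq
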